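/- Let $d \ge 2$ and let $\mathcal{M}$ be $d$-dimensional hyperbolic space (of constant curvature $-1$), that is, the sheet $x_1 > 0$ of the hyperboloid $\{x \in \mathbb{R}^{d+1} : x_2^2 + \cdots + x_{d+1}^2 = x_1^2 - 1\}$ with the Riemannian metric obtained by restricting the Minkowski semi-inner product $\langle u, v\rangle = u_2v_2 + \cdots + u_{d+1}v_{d+1} - u_1v_1$ to the tangent spaces. For $x \in \mathcal{M}$ let $\mathrm{Exp}_x \colon \mathrm{T}_x\mathcal{M} \to \mathcal{M}$ be the exponential map: $\mathrm{Exp}_x(s) = \gamma(1)$, where $\gamma$ is the unique geodesic with $\gamma(0) = x$ and $\gamma'(0) = s$. Let $f \colon \mathcal{M} \to \mathbb{R}$ be twice differentiable, with pullbacks $\hat f_x = f \circ \mathrm{Exp}_x \colon \mathrm{T}_x\mathcal{M} \to \mathbb{R}$. Here $\nabla \hat f_x$ and $\nabla^2 \hat f_x$ denote the gradient and the Hessian of $\hat f_x$ on the Euclidean space $(\mathrm{T}_x\mathcal{M}, \langle\cdot,\cdot\rangle)$, and $\|\nabla^2 \hat f_x(s)\|$ is the operator norm. If $f$ is not constant,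 then for every $\ell \ge 0$ there exist $x \in \mathcal{M}$ and $s \in \mathrm{T}_x\mathcal{M}$ such that $\|\nabla^2 \hat f_x(s)\| > \ell$. Consequently, there is no finite $\ell \ge 0$ such that $\nabla \hat f_y$ is $\ell$-Lipschitz continuous for all $y \in \mathcal{M}$. -/

import Mathlib

open scoped NNReal ContDiff

noncomputable section

namespace HyperbolicModel

/-- The ambient space `ℝ^(d+1)`: the first factor is the "time" coordinate `x₁`, the second factor
collects the remaining coordinates `x₂, …, x_n` (with `n = d + 1`). -/
abbrev Ambient (d : ℕ) : Type := ℝ × EuclideanSpace ℝ (Fin d)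

/-- The Minkowski semi-inner product `u₂ v₂ + ⋯ + u_n v_n - u₁ v₁`. -/
def mink {d : ℕ} (u v : Ambient d) : ℝ := inner ℝ u.2 v.2 - u.1 * v.1

theorem mink_comm {d : ℕ} (u v : Ambient d) : mink u v = mink v u := by
  simp only [mink, real_inner_comm, mul_comm]

theorem mink_add_left {d : ℕ} (u v w : Ambient d) : mink (u + v) w = mink u w + mink v w := by
  simp only [mink, Prod.fst_add, Prod.snd_add, inner_add_left]; ring

theorem mink_add_right {d : ℕ} (u v w : Ambient d) : mink u (v + w) = mink u v + mink u w := by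
  simp only [mink, Prod.fst_add, Prod.snd_add, inner_add_right]; ring

theorem mink_smul_left {d : ℕ} (a : ℝ) (u v : Ambient d) : mink (a • u) v = a * mink u v := by
  simp only [mink, Prod.smul_fst, Prod.smul_snd, real_inner_smul_left, smul_eq_mul]; ring

theorem mink_smul_right {d : ℕ} (a : ℝ) (u v : Ambient d) : mink u (a • v) = a * mink u v := by
  simp only [mink, Prod.smul_fst, Prod.smul_snd, real_inner_smul_right, smul_eq_mul]; ring

/-- `d`-dimensional hyperbolic space (curvature `-1`): the sheet `x₁ > 0` of the hyperboloid
`x₂² + ⋯ + x_n² = x₁² - 1`, that is, `⟨x, x⟩ = -1`. -/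
abbrev HyperbolicSpace (d : ℕ) : Type := {x : Ambient d // mink x x = -1 ∧ 0 < x.1}

/-- The global chart of hyperbolic space as an embedded submanifold of `ℝ^(d+1)`: the projection
`(x₁, x₂, …, x_n) ↦ (x₂, …, x_n)`, whose inverse is `u ↦ (√(1 + ‖u‖²), u)`. -/
def chart (d : ℕ) : HyperbolicSpace d ≃ₜ EuclideanSpace ℝ (Fin d) where
  toFun x := x.1.2
  invFun u := ⟨(Real.sqrt (1 + ‖u‖ ^ 2), u), by
    have h : (0 : ℝ) < 1 + ‖u‖ ^ 2 := by positivity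
    refine ⟨?_, Real.sqrt_pos.2 h⟩
    simp only [mink, real_inner_self_eq_norm_sq, Real.mul_self_sqrt h.le]
    ring⟩
  left_inv := by
    rintro ⟨⟨a, p⟩, h, ha⟩
    simp only [mink, real_inner_self_eq_norm_sq] at h ha
    apply Subtype.ext
    refine Prod.ext ?_ rfl
    change Real.sqrt (1 + ‖p‖ ^ 2) = a
    rw [show 1 + ‖p‖ ^ 2 = a ^ 2 by linarith, Real.sqrt_sq ha.le]
  right_inv _ := rfl
  continuous_toFun := by fun_prop
  continuous_invFun := by fun_prop

/-- `f` is differentiable and its differential is differentiable, read in the global chart. -/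
def TwiceDifferentiable {d : ℕ} (f : HyperbolicSpace d → ℝ) : Prop :=
  Differentiable ℝ (f ∘ (chart d).symm) ∧ Differentiable ℝ (fderiv ℝ (f ∘ (chart d).symm))

/-- The tangent space at `x` as a linear subspace of the ambient space:
the Minkowski-orthogonal complement of `x`. -/
def tangentSubmodule {d : ℕ} (x : HyperbolicSpace d) : Submodule ℝ (Ambient d) where
  carrier := {v | mink x.1 v = 0}
  add_mem' := by
    intro u v hu hv
    simp only [Set.mem_ofPred_eq] at hu hv ⊢
    rw [mink_add_right, hu, hv, add_zero]
  zero_mem' := by simp [mink]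
  smul_mem' := by
    intro a u hu
    simp only [Set.mem_ofPred_eq] at hu ⊢
    rw [mink_smul_right, hu, mul_zero]

/-- The tangent space `T_x M`. It is a type of its own so that its norm is the Riemannian
norm and not the norm inherited from the ambient space. -/
def Tangent {d : ℕ} (x : HyperbolicSpace d) : Type := tangentSubmodule x

instance {d : ℕ} (x : HyperbolicSpace d) : AddCommGroup (Tangent x) :=
  inferInstanceAs (AddCommGroup (tangentSubmodule x))

instance {d : ℕ} (x : HyperbolicSpace d) : Module ℝ (Tangent x) :=
  inferInstanceAs (Module ℝ (tangentSubmodule x))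

instance {d : ℕ} (x : HyperbolicSpace d) : FiniteDimensional ℝ (Tangent x) :=
  inferInstanceAs (FiniteDimensional ℝ (tangentSubmodule x))

/-- The inclusion of the tangent space into the ambient space. -/
def Tangent.incl {d : ℕ} (x : HyperbolicSpace d) : Tangent x →ₗ[ℝ] Ambient d :=
  (tangentSubmodule x).subtype

theorem Tangent.mink_incl {d : ℕ} (x : HyperbolicSpace d) (v : Tangent x) :
    mink x.1 (Tangent.incl x v) = 0 :=
  v.2

theorem Tangent.incl_injective {d : ℕ} (x : HyperbolicSpace d) :
    Function.Injective (Tangent.incl x) :=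
  Subtype.val_injective

theorem norm_sq_le_of_tangent {d : ℕ} (x : HyperbolicSpace d) (v : Ambient d)
    (hv : mink x.1 v = 0) : ‖v.2‖ ^ 2 ≤ x.1.1 ^ 2 * mink v v := by
  obtain ⟨⟨a, p⟩, h, ha⟩ := x
  obtain ⟨b, q⟩ := v
  simp only [mink, real_inner_self_eq_norm_sq] at h ha hv ⊢
  have hcs := abs_real_inner_le_norm p q
  have h2 : (inner ℝ p q) ^ 2 ≤ (‖p‖ * ‖q‖) ^ 2 := by
    rw [← sq_abs]
    gcongr
  have h3 : inner ℝ p q = a * b := by linarith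
  have h4 : ‖p‖ ^ 2 = a ^ 2 - 1 := by linarith
  rw [h3, mul_pow, mul_pow, h4] at h2
  nlinarith

/-- The Riemannian metric at `x`: the restriction of the Minkowski semi-inner product to `T_x M`,
which is positive definite there. -/
@[reducible] def tangentCore {d : ℕ} (x : HyperbolicSpace d) : InnerProductSpace.Core ℝ (Tangent x) where
  inner u v := mink (Tangent.incl x u) (Tangent.incl x v)
  conj_inner_symm u v := by
    simp only [conj_trivial]
    exact mink_comm _ _
  re_inner_nonneg v := by
    have h := norm_sq_le_of_tangent x _ (Tangent.mink_incl x v)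
    have ha : 0 < x.1.1 ^ 2 := pow_pos x.2.2 2
    exact nonneg_of_mul_nonneg_right ((sq_nonneg _).trans h) ha
  add_left u v w := by rw [map_add, mink_add_left]
  smul_left u v r := by
    rw [map_smul, mink_smul_left]
    rfl
  definite v hv := by
    have h := norm_sq_le_of_tangent x _ (Tangent.mink_incl x v)
    have hv' : mink (Tangent.incl x v) (Tangent.incl x v) = 0 := hv
    rw [hv', mul_zero] at h
    have h2 : (Tangent.incl x v).2 = 0 := by
      rw [← norm_eq_zero]
      exact pow_eq_zero_iff (two_ne_zero) |>.1 (le_antisymm h (sq_nonneg _))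
    have h1 : (Tangent.incl x v).1 = 0 := by
      simpa [mink, h2] using hv'
    apply Tangent.incl_injective x
    rw [map_zero]
    exact Prod.ext h1 h2

instance {d : ℕ} (x : HyperbolicSpace d) : NormedAddCommGroup (Tangent x) :=
  (tangentCore x).toNormedAddCommGroup

instance {d : ℕ} (x : HyperbolicSpace d) : InnerProductSpace ℝ (Tangent x) :=
  InnerProductSpace.ofCore (tangentCore x).toCore

instance {d : ℕ} (x : HyperbolicSpace d) : CompleteSpace (Tangent x) :=
  FiniteDimensional.complete ℝ (Tangent x)

theorem Tangent.inner_def {d : ℕ} (x : HyperbolicSpace d) (u v : Tangent x) :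
    inner ℝ u v = mink (Tangent.incl x u) (Tangent.incl x v) :=
  rfl

/-- The Minkowski-orthogonal projection of the ambient space onto `T_x M`
(recall `⟨x, x⟩ = -1`). -/
def tangentProj {d : ℕ} (x : HyperbolicSpace d) (v : Ambient d) : Ambient d :=
  v + mink x.1 v • x.1

/-- The intrinsic acceleration `D_t γ'` of a curve `γ` on hyperbolic space. The metric is induced by
the ambient one, so the covariant derivative along `γ` is the ambient derivative followed by the
orthogonal projection onto the tangent space. -/
def acceleration {d : ℕ} (γ : ℝ → HyperbolicSpace d) (t : ℝ) : Ambient d :=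
  tangentProj (γ t) (deriv (deriv fun τ => (γ τ).1) t)

/-- A geodesic is a smooth curve with zero acceleration. -/
def IsGeodesic {d : ℕ} (γ : ℝ → HyperbolicSpace d) : Prop :=
  ContDiff ℝ ∞ (fun t => (γ t).1) ∧ ∀ t, acceleration γ t = 0

/-- `γ` is a geodesic through `x` with velocity `s` at time zero. -/
def IsGeodesicFrom {d : ℕ} (x : HyperbolicSpace d) (s : Tangent x)
    (γ : ℝ → HyperbolicSpace d) : Prop :=
  IsGeodesic γ ∧ γ 0 = x ∧ deriv (fun t => (γ t).1) 0 = Tangent.incl x s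

theorem hasDerivAt_mink {d : ℕ} {u v : ℝ → Ambient d} {u' v' : Ambient d} {t : ℝ}
    (hu : HasDerivAt u u' t) (hv : HasDerivAt v v' t) :
    HasDerivAt (fun τ => mink (u τ) (v τ)) (mink (u t) v' + mink u' (v t)) t := by
  have hu1 : HasDerivAt (fun τ => (u τ).1) u'.1 t := by
    simpa using hu.hasFDerivAt.fst.hasDerivAt
  have hu2 : HasDerivAt (fun τ => (u τ).2) u'.2 t := by
    simpa using hu.hasFDerivAt.snd.hasDerivAt
  have hv1 : HasDerivAt (fun τ => (v τ).1) v'.1 t := by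
    simpa using hv.hasFDerivAt.fst.hasDerivAt
  have hv2 : HasDerivAt (fun τ => (v τ).2) v'.2 t := by
    simpa using hv.hasFDerivAt.snd.hasDerivAt
  refine ((hu2.inner ℝ hv2).sub (hu1.mul hv1)).congr_deriv ?_
  simp only [mink]
  ring

/-- A geodesic solves the linear equation `c'' = ‖s‖² c` in the ambient space. -/
theorem IsGeodesicFrom.ode {d : ℕ} {x : HyperbolicSpace d} {s : Tangent x}
    {γ : ℝ → HyperbolicSpace d} (h : IsGeodesicFrom x s γ) (t : ℝ) :
    HasDerivAt (fun τ => (γ τ).1) (deriv (fun τ => (γ τ).1) t) t ∧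
      HasDerivAt (deriv fun τ => (γ τ).1) (‖s‖ ^ 2 • (γ t).1) t := by
  obtain ⟨⟨hsm, hacc⟩, h0, h0'⟩ := h
  set c : ℝ → Ambient d := fun τ => (γ τ).1 with hc
  have hd1 : ∀ t, HasDerivAt c (deriv c t) t := fun t =>
    (hsm.differentiable (by simp)).differentiableAt.hasDerivAt
  have hsm' : ContDiff ℝ ∞ (deriv c) := (contDiff_infty_iff_deriv.1 hsm).2
  have hd2 : ∀ t, HasDerivAt (deriv c) (deriv (deriv c) t) t := fun t =>
    (hsm'.differentiable (by simp)).differentiableAt.hasDerivAt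
  have hcc : ∀ t, mink (c t) (c t) = -1 := fun t => (γ t).2.1
  have hcc' : ∀ t, mink (c t) (deriv c t) = 0 := by
    intro t
    have h1 := hasDerivAt_mink (hd1 t) (hd1 t)
    have h2 : HasDerivAt (fun τ => mink (c τ) (c τ)) 0 t := by
      simp only [hcc]
      exact hasDerivAt_const t _
    have h3 := h1.unique h2
    rw [mink_comm (deriv c t)] at h3
    linarith
  have hcc'' : ∀ t, mink (c t) (deriv (deriv c) t) = - mink (deriv c t) (deriv c t) := by
    intro t
    have h1 := hasDerivAt_mink (hd1 t) (hd2 t)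
    have h2 : HasDerivAt (fun τ => mink (c τ) (deriv c τ)) 0 t := by
      simp only [hcc']
      exact hasDerivAt_const t _
    have h3 := h1.unique h2
    linarith
  have hode : ∀ t, deriv (deriv c) t = mink (deriv c t) (deriv c t) • c t := by
    intro t
    have h1 : deriv (deriv c) t + mink (c t) (deriv (deriv c) t) • c t = 0 := hacc t
    rw [hcc'', neg_smul] at h1
    exact add_neg_eq_zero.1 h1
  have hK : ∀ t, mink (deriv c t) (deriv c t) = ‖s‖ ^ 2 := by
    have hder : ∀ t, HasDerivAt (fun τ => mink (deriv c τ) (deriv c τ)) 0 t := by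
      intro t
      refine (hasDerivAt_mink (hd2 t) (hd2 t)).congr_deriv ?_
      rw [mink_comm (deriv (deriv c) t), hode t, mink_smul_right, mink_comm _ (c t), hcc']
      simp
    intro t
    have h1 := is_const_of_deriv_eq_zero (fun t => (hder t).differentiableAt)
      (fun t => (hder t).deriv) t 0
    rw [h1, h0', ← real_inner_self_eq_norm_sq, Tangent.inner_def]
  refine ⟨hd1 t, ?_⟩
  have := hd2 t
  rwa [hode t, hK t] at this

theorem IsGeodesicFrom.eq {d : ℕ} {x : HyperbolicSpace d} {s : Tangent x}
    {γ₁ γ₂ : ℝ → HyperbolicSpace d} (h₁ : IsGeodesicFrom x s γ₁) (h₂ : IsGeodesicFrom x s γ₂) :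
    γ₁ = γ₂ := by
  let A : Ambient d × Ambient d →L[ℝ] Ambient d × Ambient d :=
    (ContinuousLinearMap.snd ℝ _ _).prod (‖s‖ ^ 2 • ContinuousLinearMap.fst ℝ _ _)
  have key : ∀ γ : ℝ → HyperbolicSpace d, IsGeodesicFrom x s γ → ∀ t,
      HasDerivAt (fun τ => ((γ τ).1, deriv (fun τ => (γ τ).1) τ))
        (A ((γ t).1, deriv (fun τ => (γ τ).1) t)) t := by
    intro γ h t
    exact (h.ode t).1.prodMk (h.ode t).2
  have heq := ODE_solution_unique_univ (v := fun _ => A) (s := fun _ => Set.univ) (t₀ := 0)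
    (fun _ => A.lipschitz.lipschitzOnWith) (fun t => ⟨key γ₁ h₁ t, Set.mem_univ _⟩)
    (fun t => ⟨key γ₂ h₂ t, Set.mem_univ _⟩)
    (by rw [h₁.2.2, h₂.2.2, h₁.2.1, h₂.2.1])
  funext t
  exact Subtype.ext (congrArg Prod.fst (congrFun heq t))

/-- The ambient expression of the geodesic through `x` with velocity `s`. -/
def geodesicVal {d : ℕ} (x : HyperbolicSpace d) (s : Tangent x) (t : ℝ) : Ambient d :=
  Real.cosh (‖s‖ * t) • x.1 + (Real.sinh (‖s‖ * t) / ‖s‖) • Tangent.incl x s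

theorem norm_smul_div {d : ℕ} (x : HyperbolicSpace d) (s : Tangent x) (a : ℝ) :
    (a * ‖s‖ / ‖s‖) • Tangent.incl x s = a • Tangent.incl x s := by
  by_cases hs : s = 0
  · simp [hs]
  · rw [mul_div_cancel_right₀ _ (norm_ne_zero_iff.2 hs)]

theorem mink_geodesicVal {d : ℕ} (x : HyperbolicSpace d) (s : Tangent x) (t : ℝ) :
    mink (geodesicVal x s t) (geodesicVal x s t) = -1 := by
  have h1 : mink (Tangent.incl x s) (Tangent.incl x s) = ‖s‖ ^ 2 := by
    rw [← real_inner_self_eq_norm_sq, Tangent.inner_def]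
  have h2 := Tangent.mink_incl x s
  simp only [geodesicVal, mink_add_left, mink_add_right, mink_smul_left, mink_smul_right,
    mink_comm (Tangent.incl x s) x.1, h1, h2, x.2.1]
  by_cases hs : ‖s‖ = 0
  · simp [hs]
  · field_simp
    linear_combination (-‖s‖) * Real.cosh_sq (‖s‖ * t)

theorem hasDerivAt_geodesicVal {d : ℕ} (x : HyperbolicSpace d) (s : Tangent x) (t : ℝ) :
    HasDerivAt (geodesicVal x s)
      ((Real.sinh (‖s‖ * t) * ‖s‖) • x.1 + Real.cosh (‖s‖ * t) • Tangent.incl x s) t := by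
  have hl : HasDerivAt (fun τ : ℝ => ‖s‖ * τ) ‖s‖ t := by
    simpa using (hasDerivAt_id t).const_mul ‖s‖
  have h := (hl.cosh.smul_const x.1).add ((hl.sinh.div_const ‖s‖).smul_const (Tangent.incl x s))
  rw [norm_smul_div] at h
  exact h

theorem deriv_deriv_geodesicVal {d : ℕ} (x : HyperbolicSpace d) (s : Tangent x) (t : ℝ) :
    deriv (deriv (geodesicVal x s)) t = ‖s‖ ^ 2 • geodesicVal x s t := by
  have h1 : deriv (geodesicVal x s) = fun t =>
      (Real.sinh (‖s‖ * t) * ‖s‖) • x.1 + Real.cosh (‖s‖ * t) • Tangent.incl x s :=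
    funext fun t => (hasDerivAt_geodesicVal x s t).deriv
  have hl : HasDerivAt (fun τ : ℝ => ‖s‖ * τ) ‖s‖ t := by
    simpa using (hasDerivAt_id t).const_mul ‖s‖
  have h := ((hl.sinh.mul_const ‖s‖).smul_const x.1).add (hl.cosh.smul_const (Tangent.incl x s))
  rw [h1]
  refine h.deriv.trans ?_
  rw [← norm_smul_div x s (Real.sinh (‖s‖ * t) * ‖s‖), geodesicVal, smul_add, smul_smul, smul_smul]
  congr 2 <;> ring

theorem contDiff_geodesicVal {d : ℕ} (x : HyperbolicSpace d) (s : Tangent x) :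
    ContDiff ℝ ∞ (geodesicVal x s) := by
  unfold geodesicVal
  have hl : ContDiff ℝ ∞ (fun τ : ℝ => ‖s‖ * τ) := contDiff_const.mul contDiff_id
  exact (hl.cosh.smul contDiff_const).add ((hl.sinh.div_const _).smul contDiff_const)

theorem fst_geodesicVal_pos {d : ℕ} (x : HyperbolicSpace d) (s : Tangent x) (t : ℝ) :
    0 < (geodesicVal x s t).1 := by
  have hne : ∀ τ, (geodesicVal x s τ).1 ≠ 0 := by
    intro τ h0
    have h := mink_geodesicVal x s τ
    simp only [mink, h0, real_inner_self_eq_norm_sq] at h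
    nlinarith [sq_nonneg ‖(geodesicVal x s τ).2‖]
  by_contra hle
  rw [not_lt] at hle
  have hcont : Continuous fun τ => (geodesicVal x s τ).1 :=
    continuous_fst.comp (contDiff_geodesicVal x s).continuous
  have hpos : 0 < (geodesicVal x s 0).1 := by
    simpa [geodesicVal] using x.2.2
  obtain ⟨τ, hτ⟩ := mem_range_of_exists_le_of_exists_ge hcont ⟨t, hle⟩ ⟨0, hpos.le⟩
  exact hne τ hτ

theorem isGeodesicFrom_geodesicVal {d : ℕ} (x : HyperbolicSpace d) (s : Tangent x) :
    IsGeodesicFrom x s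
      (fun t => ⟨geodesicVal x s t, mink_geodesicVal x s t, fst_geodesicVal_pos x s t⟩) := by
  refine ⟨⟨contDiff_geodesicVal x s, fun t => ?_⟩, ?_, ?_⟩
  · change deriv (deriv (geodesicVal x s)) t
      + mink (geodesicVal x s t) (deriv (deriv (geodesicVal x s)) t) • geodesicVal x s t = 0
    rw [deriv_deriv_geodesicVal, mink_smul_right, mink_geodesicVal]
    simp
  · apply Subtype.ext
    simp [geodesicVal]
  · refine (hasDerivAt_geodesicVal x s 0).deriv.trans ?_
    simp

theorem existsUnique_geodesic {d : ℕ} (x : HyperbolicSpace d) (s : Tangent x) :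
    ∃! γ : ℝ → HyperbolicSpace d, IsGeodesicFrom x s γ :=
  ⟨_, isGeodesicFrom_geodesicVal x s, fun _ h => h.eq (isGeodesicFrom_geodesicVal x s)⟩

/-- The exponential map: `Exp_x(s) = γ(1)`, where `γ` is the unique geodesic with `γ(0) = x` and
`γ'(0) = s`. -/
def Exp {d : ℕ} (x : HyperbolicSpace d) (s : Tangent x) : HyperbolicSpace d :=
  (existsUnique_geodesic x s).choose 1

/-- The value of the exponential map in the ambient space. -/
theorem Exp_val {d : ℕ} (x : HyperbolicSpace d) (s : Tangent x) :
    (Exp x s).1 = Real.cosh ‖s‖ • x.1 + (Real.sinh ‖s‖ / ‖s‖) • Tangent.incl x s := by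
  have h := (existsUnique_geodesic x s).choose_spec.1.eq (isGeodesicFrom_geodesicVal x s)
  rw [Exp, h]
  simp [geodesicVal]

/-- The pullback `f ∘ Exp_x : T_x M → ℝ`. -/
def pullback {d : ℕ} (f : HyperbolicSpace d → ℝ) (x : HyperbolicSpace d) : Tangent x → ℝ :=
  f ∘ Exp x

/-- The Hessian of a real function on a Euclidean space: the derivative of its gradient, as a
linear operator (so that its norm is the operator norm). -/
def hessian {E : Type*} [NormedAddCommGroup E] [InnerProductSpace ℝ E] [CompleteSpace E]
    (g : E → ℝ) (s : E) : E →L[ℝ] E :=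
  fderiv ℝ (gradient g) s

end HyperbolicModel

end

namespace HyperbolicModel

/-! Negative curvature makes the exponential map expand exponentially, so a nonzero derivative of
`f` at a single point forces large Hessians of the pullbacks from far away.

Fix `y` and orthogonal unit tangent vectors `u`, `v` there; this is where `d ≥ 2` enters. For `R >
0` step back from `y` along the geodesic with velocity `v` to a point `x` at distance `R`, and write
`y = Exp_x(s)`. The vector `u` is also tangent at `x` and orthogonal to `s`. With `g` denoting `f`
read in the chart, the second derivative of the pullback at `s` in direction `u`, multiplied by
`R²`, is `sinh² R · H + (R - sinh R cosh R) · Dg(v)`, where `H = D²g(u, u) + Dg(y)` does not depend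
on `v` or `R` (`inner_hessian_pullback`, `exists_Exp_eq`, `abs_le_of_hessian_bound`).

If all Hessians are bounded by `ℓ`, this expression is at most `ℓ R²` in absolute value. Replacing
`v` by `-v` reverses only the second term, so half the difference of the two bounds removes `H`,
leaving `|(R - sinh R cosh R) · Dg(v)| ≤ ℓ R²` for every `R > 0`. Exponential growth against `R²`
gives `Dg(v) = 0` (`eq_zero_of_sinh_mul_cosh_bound`). Hence `Dg` vanishes everywhere and `f` is
constant. -/

theorem Tangent.mink_self {d : ℕ} (x : HyperbolicSpace d) (v : Tangent x) :
    mink (Tangent.incl x v) (Tangent.incl x v) = ‖v‖ ^ 2 := by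
  rw [← real_inner_self_eq_norm_sq, Tangent.inner_def]

/-- The time coordinate of a tangent vector is determined by its space coordinates. -/
theorem Tangent.exists_snd_eq {d : ℕ} (x : HyperbolicSpace d) (q : EuclideanSpace ℝ (Fin d)) :
    ∃ v : Tangent x, (Tangent.incl x v).2 = q := by
  refine ⟨(⟨(inner ℝ x.1.2 q / x.1.1, q), ?_⟩ : tangentSubmodule x), rfl⟩
  change inner ℝ x.1.2 q - x.1.1 * (inner ℝ x.1.2 q / x.1.1) = 0
  rw [mul_div_cancel₀ _ x.2.2.ne', sub_self]

/-- In dimension at least two every tangent vector has a unit vector orthogonal to it. -/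
theorem Tangent.exists_unit_orthogonal {d : ℕ} (hd : 2 ≤ d) (x : HyperbolicSpace d)
    (v : Tangent x) : ∃ u : Tangent x, ‖u‖ = 1 ∧ inner ℝ v u = 0 := by
  have hle : d ≤ Module.finrank ℝ (Tangent x) := by
    -- The projection to the space coordinates is onto, so the tangent space has dimension at least
    -- `d`, more than the line spanned by `v`.
    let π : Tangent x →ₗ[ℝ] EuclideanSpace ℝ (Fin d) := LinearMap.snd ℝ ℝ _ ∘ₗ Tangent.incl x
    have hπ : LinearMap.range π = ⊤ := LinearMap.range_eq_top.2 (Tangent.exists_snd_eq x)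
    have h := LinearMap.finrank_range_le π
    rwa [hπ, finrank_top, finrank_euclideanSpace_fin] at h
  have hspan : Module.finrank ℝ (Submodule.span ℝ {v}) ≤ 1 := by
    simpa using finrank_span_le_card (R := ℝ) {v}
  have hne : (Submodule.span ℝ {v})ᗮ ≠ ⊥ := by
    intro h
    have h' := (Submodule.span ℝ {v}).finrank_add_finrank_orthogonal
    rw [h, finrank_bot] at h'
    omega
  obtain ⟨w, hw, hw0⟩ := Submodule.exists_mem_ne_zero_of_ne_bot hne
  refine ⟨‖w‖⁻¹ • w, ?_, ?_⟩
  · rw [norm_smul, norm_inv, norm_norm, inv_mul_cancel₀ (norm_ne_zero_iff.2 hw0)]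
  · rw [inner_smul_right, Submodule.mem_orthogonal_singleton_iff_inner_right.1 hw, mul_zero]

/-- The space coordinates of the exponential map are smooth away from the origin. -/
theorem contDiffAt_Exp_snd {d : ℕ} (x : HyperbolicSpace d) {s : Tangent x} (hs : s ≠ 0) :
    ContDiffAt ℝ 2 (fun s => (Exp x s).1.2) s := by
  have hn : ContDiffAt ℝ 2 (fun s : Tangent x => ‖s‖) s := contDiffAt_norm ℝ hs
  have hi : ContDiff ℝ 2 (fun s : Tangent x => (Tangent.incl x s).2) :=
    (LinearMap.toContinuousLinearMap
      (LinearMap.snd ℝ ℝ (EuclideanSpace ℝ (Fin d)) ∘ₗ Tangent.incl x)).contDiff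
  have h : (fun s => (Exp x s).1.2) = fun s : Tangent x =>
      Real.cosh ‖s‖ • x.1.2 + (Real.sinh ‖s‖ / ‖s‖) • (Tangent.incl x s).2 := by
    funext s
    rw [Exp_val]
    rfl
  rw [h]
  exact (hn.cosh.smul contDiffAt_const).add
    ((hn.sinh.div hn (norm_ne_zero_iff.2 hs)).smul hi.contDiffAt)

/-! ### Second derivatives of compositions under mere twice differentiability -/

section Gradient

variable {E F : Type*} [NormedAddCommGroup E] [InnerProductSpace ℝ E] [CompleteSpace E]
  [NormedAddCommGroup F] [NormedSpace ℝ F]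

/-- The gradient of the composition of a twice differentiable function with a `C²` map is
differentiable. -/
theorem differentiableAt_gradient_comp {g : F → ℝ} (hg : Differentiable ℝ g)
    (hg' : Differentiable ℝ (fderiv ℝ g)) {Q : E → F} {s : E} (hQ : ContDiffAt ℝ 2 Q s) :
    DifferentiableAt ℝ (gradient (g ∘ Q)) s := by
  -- Since `g` need not be `C²`, the chain rule is written out and its two factors are
  -- differentiated separately. The identity is needed only near `s`, where `Q` is regular.
  have h1 : ∀ᶠ z in nhds s, gradient (g ∘ Q) z =
      (InnerProductSpace.toDual ℝ E).symm ((fderiv ℝ g (Q z)).comp (fderiv ℝ Q z)) := by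
    filter_upwards [hQ.eventually (by simp)] with z hz
    rw [gradient, fderiv_comp z (hg _) (hz.differentiableAt (by simp))]
  refine DifferentiableAt.congr_of_eventuallyEq ?_ h1
  refine (InnerProductSpace.toDual ℝ E).symm.differentiable.differentiableAt.comp s ?_
  refine DifferentiableAt.clm_comp ?_ ?_
  · exact (hg' (Q s)).comp s (hQ.differentiableAt (by simp))
  · exact (hQ.fderiv_right (m := 1) (by norm_num)).differentiableAt (by simp)

/-- The Hessian gives the second derivative along lines. -/
theorem hasDerivAt_deriv_line {G : E → ℝ} {s w : E}
    (hG : ∀ t : ℝ, DifferentiableAt ℝ G (s + t • w)) (hG' : DifferentiableAt ℝ (gradient G) s) :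
    HasDerivAt (deriv fun t : ℝ => G (s + t • w)) (inner ℝ (hessian G s w) w) 0 := by
  have hline : ∀ t : ℝ, HasDerivAt (fun t : ℝ => s + t • w) w t := fun t => by
    simpa using ((hasDerivAt_id t).smul_const w).const_add s
  have h1 : (deriv fun t : ℝ => G (s + t • w)) = fun t => inner ℝ (gradient G (s + t • w)) w := by
    funext t
    have := ((hG t).hasGradientAt.hasFDerivAt.comp_hasDerivAt t (hline t)).deriv
    simpa [Function.comp_def] using this
  rw [h1]
  have h2 : HasFDerivAt (gradient G) (hessian G s) (s + (0 : ℝ) • w) := by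
    simpa [hessian] using hG'.hasFDerivAt
  have h3 := (h2.comp_hasDerivAt 0 (hline 0)).inner ℝ (hasDerivAt_const 0 w)
  simpa using h3

/-- The second derivative of a composition of a twice differentiable function with a curve. -/
theorem hasDerivAt_deriv_comp_curve {g : F → ℝ} (hg : Differentiable ℝ g)
    (hg' : Differentiable ℝ (fderiv ℝ g)) {q q' : ℝ → F} {a : F} {t : ℝ}
    (hq : ∀ t, HasDerivAt q (q' t) t) (hq' : HasDerivAt q' a t) :
    HasDerivAt (deriv fun t => g (q t))
      (fderiv ℝ (fderiv ℝ g) (q t) (q' t) (q' t) + fderiv ℝ g (q t) a) t := by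
  have h1 : (deriv fun t => g (q t)) = fun t => fderiv ℝ g (q t) (q' t) :=
    funext fun t => ((hg (q t)).hasFDerivAt.comp_hasDerivAt t (hq t)).deriv
  rw [h1]
  exact ((hg' (q t)).hasFDerivAt.comp_hasDerivAt t (hq t)).clm_apply hq'

end Gradient

/-! ### The pullback along a line orthogonal to `s` -/

/-- A curve `cosh r(t) • p + (sinh r(t) / r(t)) • (e + t • w)` with `r(t)² = R² + t²`: its first
derivative everywhere, the value of that derivative at zero, and its second derivative at zero. -/
theorem exists_hasDerivAt_expCurve {F : Type*} [NormedAddCommGroup F] [NormedSpace ℝ F]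
    (p e w : F) {R : ℝ} (hR : 0 < R) :
    ∃ q' : ℝ → F,
      (∀ t, HasDerivAt (fun t : ℝ => Real.cosh √(R ^ 2 + t ^ 2) • p +
        (Real.sinh √(R ^ 2 + t ^ 2) / √(R ^ 2 + t ^ 2)) • (e + t • w)) (q' t) t) ∧
      q' 0 = (Real.sinh R / R) • w ∧
      HasDerivAt q' ((Real.sinh R / R) • p +
        ((R * Real.cosh R - Real.sinh R) / R ^ 3) • e) 0 := by
  set r : ℝ → ℝ := fun t => √(R ^ 2 + t ^ 2) with hr
  have hpos : ∀ t, 0 < r t := fun t => Real.sqrt_pos.2 (by positivity)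
  have hr0 : r 0 = R := by simp [hr, Real.sqrt_sq hR.le]
  have hr' : ∀ t, HasDerivAt r (t / r t) t := by
    intro t
    have h : HasDerivAt (fun t : ℝ => R ^ 2 + t ^ 2) (2 * t) t := by
      simpa using (hasDerivAt_pow 2 t).const_add (R ^ 2)
    refine (h.sqrt (by positivity)).congr_deriv ?_
    have := (hpos t).ne'
    change 2 * t / (2 * r t) = _
    field_simp
  -- As `r' = t / r`, differentiating a function of `r` in `t` gives `t` times its `r`-derivative
  -- over `r`: `cosh r` yields `t * S`, and `S` yields `t * T`.
  set S : ℝ → ℝ := fun t => Real.sinh (r t) / r t with hS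
  set T : ℝ → ℝ := fun t => (r t * Real.cosh (r t) - Real.sinh (r t)) / r t ^ 3 with hT
  have hC' : ∀ t, HasDerivAt (fun t => Real.cosh (r t)) (t * S t) t := fun t =>
    (hr' t).cosh.congr_deriv (by simp only [hS]; ring)
  have hS' : ∀ t, HasDerivAt S (t * T t) t := fun t =>
    ((hr' t).sinh.div (hr' t) (hpos t).ne').congr_deriv (by
      have := (hpos t).ne'
      simp only [hT]
      field_simp)
  -- The value of `T'` is irrelevant: in the derivative of `t * T t` at `0` it is multiplied by `t =
  -- 0`.
  have hT' : DifferentiableAt ℝ T 0 := by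
    have h := (hr' 0).differentiableAt
    exact ((h.mul h.cosh).sub h.sinh).div (h.pow 3) (pow_ne_zero 3 (hpos 0).ne')
  have hl : ∀ t : ℝ, HasDerivAt (fun t : ℝ => e + t • w) w t := fun t => by
    simpa using ((hasDerivAt_id t).smul_const w).const_add e
  refine ⟨fun t => (t * S t) • p + (S t • w + (t * T t) • (e + t • w)), fun t => ?_, ?_, ?_⟩
  · exact ((hC' t).smul_const p).add ((hS' t).smul (hl t))
  · simp [hS, hr0]
  · have h1 := ((hasDerivAt_id (0 : ℝ)).mul (hS' 0)).smul_const p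
    have h2 := (hS' 0).smul_const w
    have h3 := ((hasDerivAt_id (0 : ℝ)).mul hT'.hasDerivAt).smul (hl 0)
    refine (h1.add (h2.add h3)).congr_deriv ?_
    simp [hS, hT, hr0]

/-- The second derivative of a pullback in a direction `w` orthogonal to `s`. -/
theorem inner_hessian_pullback {d : ℕ} {f : HyperbolicSpace d → ℝ} (hf : TwiceDifferentiable f)
    (x : HyperbolicSpace d) {s w : Tangent x} (hs : s ≠ 0) (hw : ‖w‖ = 1)
    (hsw : inner ℝ s w = 0) :
    inner ℝ (hessian (pullback f x) s w) w =
      (Real.sinh ‖s‖ / ‖s‖) ^ 2 * fderiv ℝ (fderiv ℝ (f ∘ (chart d).symm)) (Exp x s).1.2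
          (Tangent.incl x w).2 (Tangent.incl x w).2 +
        fderiv ℝ (f ∘ (chart d).symm) (Exp x s).1.2
          ((Real.sinh ‖s‖ / ‖s‖) • x.1.2 +
            ((‖s‖ * Real.cosh ‖s‖ - Real.sinh ‖s‖) / ‖s‖ ^ 3) • (Tangent.incl x s).2) := by
  set g := f ∘ (chart d).symm with hg
  have hG : pullback f x = g ∘ fun s => (Exp x s).1.2 := by
    funext z
    exact congrArg f ((chart d).symm_apply_apply (Exp x z)).symm
  have hnorm : ∀ t : ℝ, ‖s + t • w‖ = √(‖s‖ ^ 2 + t ^ 2) := by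
    intro t
    rw [← Real.sqrt_sq (norm_nonneg (s + t • w)), norm_add_sq_real, inner_smul_right, hsw,
      norm_smul, hw]
    simp
  have hR : 0 < ‖s‖ := norm_pos_iff.2 hs
  -- By orthogonality the line avoids the origin, the only point where the norm is not smooth.
  have hne : ∀ t : ℝ, s + t • w ≠ 0 := fun t => by
    rw [← norm_pos_iff, hnorm]
    positivity
  have hline := hasDerivAt_deriv_line (G := pullback f x) (s := s) (w := w)
    (fun t => by
      rw [hG]
      exact (hf.1 _).comp _ ((contDiffAt_Exp_snd x (hne t)).differentiableAt (by simp)))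
    (by
      rw [hG]
      exact differentiableAt_gradient_comp hf.1 hf.2 (contDiffAt_Exp_snd x hs))
  obtain ⟨q', hq, hq0, hq'⟩ :=
    exists_hasDerivAt_expCurve x.1.2 (Tangent.incl x s).2 (Tangent.incl x w).2 hR
  have hcurve : (fun t : ℝ => (Exp x (s + t • w)).1.2) = fun t : ℝ =>
      Real.cosh √(‖s‖ ^ 2 + t ^ 2) • x.1.2 +
        (Real.sinh √(‖s‖ ^ 2 + t ^ 2) / √(‖s‖ ^ 2 + t ^ 2)) •
          ((Tangent.incl x s).2 + t • (Tangent.incl x w).2) := by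
    funext t
    rw [Exp_val, hnorm, map_add, map_smul]
    rfl
  rw [← hcurve] at hq
  have h := hasDerivAt_deriv_comp_curve hf.1 hf.2 hq hq'
  have h' : (fun t : ℝ => pullback f x (s + t • w)) =
      fun t => g ((fun t : ℝ => (Exp x (s + t • w)).1.2) t) := by
    rw [hG]
    rfl
  rw [h'] at hline
  rw [hline.unique h, hq0]
  simp only [zero_smul, add_zero, map_smul, smul_apply, smul_eq_mul, sq]
  ring

/-! ### Hessians at a fixed point seen from a distance -/

/-- Moving back a distance `R` from `y` along the geodesic with unit velocity `v` gives a point `x`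
and a tangent vector `s` with `Exp_x(s) = y`; vectors orthogonal to `v` at `y` are also tangent
at `x`. -/
theorem exists_Exp_eq {d : ℕ} (y : HyperbolicSpace d) {u v : Tangent y} (hv : ‖v‖ = 1)
    (hu : ‖u‖ = 1) (hvu : inner ℝ v u = 0) {R : ℝ} (hR : 0 < R) :
    ∃ (x : HyperbolicSpace d) (s w : Tangent x), Exp x s = y ∧ ‖s‖ = R ∧ ‖w‖ = 1 ∧
      inner ℝ s w = 0 ∧ Tangent.incl x w = Tangent.incl y u ∧
      x.1 = Real.cosh R • y.1 - Real.sinh R • Tangent.incl y v ∧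
      Tangent.incl x s =
        R • (Real.cosh R • Tangent.incl y v - Real.sinh R • y.1) := by
  have hyv := Tangent.mink_incl y v
  have hvy := hyv
  rw [mink_comm] at hvy
  have hyu := Tangent.mink_incl y u
  have hvv : mink (Tangent.incl y v) (Tangent.incl y v) = 1 := by rw [Tangent.mink_self, hv]; simp
  have hvu' : mink (Tangent.incl y v) (Tangent.incl y u) = 0 := hvu
  have hyy := y.2.1
  obtain ⟨x, hx⟩ : ∃ x : HyperbolicSpace d,
      x.1 = Real.cosh R • y.1 - Real.sinh R • Tangent.incl y v := by
    refine ⟨Exp y (-(R • v)), ?_⟩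
    have hn : ‖-(R • v)‖ = R := by rw [norm_neg, norm_smul, hv, mul_one, Real.norm_of_nonneg hR.le]
    rw [Exp_val, hn, map_neg, map_smul, smul_neg, smul_smul, div_mul_cancel₀ _ hR.ne', sub_eq_add_neg]
  have hcs := Real.cosh_sq R
  -- The vector is `R` times the velocity at `x` of the unit speed geodesic from `x` to `y`.
  have hs : mink x.1 (R • (Real.cosh R • Tangent.incl y v - Real.sinh R • y.1)) = 0 := by
    simp only [hx, sub_eq_add_neg, ← neg_smul, mink_add_left, mink_add_right, mink_smul_left,
      mink_smul_right, hyv, hvy, hvv, hyy]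
    ring
  -- Both `y` and `v` are Minkowski-orthogonal to `u`, and `x` lies in their span.
  have hw : mink x.1 (Tangent.incl y u) = 0 := by
    simp only [hx, sub_eq_add_neg, ← neg_smul, mink_add_left, mink_smul_left, hyu, hvu']
    ring
  let s : Tangent x := (⟨_, hs⟩ : tangentSubmodule x)
  let w : Tangent x := (⟨_, hw⟩ : tangentSubmodule x)
  have hsi : Tangent.incl x s = R • (Real.cosh R • Tangent.incl y v - Real.sinh R • y.1) := rfl
  have hwi : Tangent.incl x w = Tangent.incl y u := rfl
  have hsn : ‖s‖ = R := by
    rw [← sq_eq_sq₀ (norm_nonneg _) hR.le, ← Tangent.mink_self, hsi]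
    simp only [sub_eq_add_neg, ← neg_smul, mink_add_left, mink_add_right, mink_smul_left,
      mink_smul_right, hyv, hvy, hvv, hyy]
    linear_combination R ^ 2 * hcs
  refine ⟨x, s, w, ?_, hsn, ?_, ?_, hwi, hx, hsi⟩
  · apply Subtype.ext
    rw [Exp_val, hsn, hsi, hx, smul_smul, div_mul_cancel₀ _ hR.ne']
    match_scalars
    · linear_combination hcs
    · ring
  · rw [← sq_eq_sq₀ (norm_nonneg _) zero_le_one, ← Tangent.mink_self, hwi, Tangent.mink_self, hu]
  · rw [Tangent.inner_def, hsi, hwi]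
    simp only [sub_eq_add_neg, ← neg_smul, mink_add_left, mink_smul_left, hyu, hvu']
    ring

/-- A bound on the Hessians of all pullbacks, read at `y = Exp_x(s)` with `‖s‖ = R`, where `x` lies
on the geodesic through `y` with velocity `v`, in a direction `u` orthogonal to `v`. -/
theorem abs_le_of_hessian_bound {d : ℕ} {f : HyperbolicSpace d → ℝ} (hf : TwiceDifferentiable f)
    {ℓ : ℝ} (hℓ : ∀ (x : HyperbolicSpace d) (s : Tangent x), ‖hessian (pullback f x) s‖ ≤ ℓ)
    (y : HyperbolicSpace d) {u v : Tangent y} (hv : ‖v‖ = 1)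
    (hu : ‖u‖ = 1) (hvu : inner ℝ v u = 0) {R : ℝ} (hR : 0 < R) :
    |Real.sinh R ^ 2 * (fderiv ℝ (fderiv ℝ (f ∘ (chart d).symm)) y.1.2
        (Tangent.incl y u).2 (Tangent.incl y u).2 + fderiv ℝ (f ∘ (chart d).symm) y.1.2 y.1.2) +
      (R - Real.sinh R * Real.cosh R) *
        fderiv ℝ (f ∘ (chart d).symm) y.1.2 (Tangent.incl y v).2| ≤ ℓ * R ^ 2 := by
  obtain ⟨x, s, w, hE, hs, hw, hsw, hwi, hx, hsi⟩ := exists_Exp_eq y hv hu hvu hR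
  have hs0 : s ≠ 0 := by rw [← norm_pos_iff, hs]; exact hR
  have h := inner_hessian_pullback hf x hs0 hw hsw
  have hb : |inner ℝ (hessian (pullback f x) s w) w| ≤ ℓ := by
    refine (abs_real_inner_le_norm _ _).trans ?_
    rw [hw, mul_one]
    refine ((hessian (pullback f x) s).le_opNorm w).trans ?_
    rw [hw, mul_one]
    exact hℓ x s
  rw [h, hE, hs, hwi, hx, hsi] at hb
  -- Multiplying by `R²` clears the denominators. Substituting `x` and `s` in terms of `y` and `v`,
  -- the identity `cosh² - sinh² = 1` reduces the coefficient of `Dg(v)` to `R - sinh R cosh R`.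
  have hmul := mul_le_mul_of_nonneg_right hb (sq_nonneg R)
  rw [← abs_of_nonneg (sq_nonneg R), ← abs_mul, abs_of_nonneg (sq_nonneg R)] at hmul
  refine le_of_eq_of_le (congrArg _ ?_) hmul
  simp only [Prod.snd_sub, Prod.smul_snd, map_add, map_sub, map_smul, smul_eq_mul]
  have hcs := Real.cosh_sq R
  have := hR.ne'
  field_simp
  linear_combination (-R * fderiv ℝ (f ∘ (chart d).symm) y.1.2 (Tangent.incl y v).2) * hcs

/-! ### Exponential growth and conclusion -/

/-- `sinh R cosh R = sinh(2R) / 2` outgrows every multiple of `R²`; the cubic term of `exp(2R)`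
already suffices. -/
theorem eq_zero_of_sinh_mul_cosh_bound {B ℓ : ℝ}
    (h : ∀ R : ℝ, 0 < R → |(R - Real.sinh R * Real.cosh R) * B| ≤ ℓ * R ^ 2) : B = 0 := by
  by_contra hB
  have hB' : 0 < |B| := abs_pos.2 hB
  have hℓ : 0 ≤ ℓ := by simpa using (abs_nonneg _).trans (h 1 one_pos)
  -- `R ≥ 4` gives `sinh R cosh R - R ≥ R³ / 4`, so the bound would force `R |B| ≤ 4ℓ`; this choice
  -- makes `R |B|` exceed `4ℓ` by `4 |B|`.
  obtain ⟨R, hR⟩ : ∃ R : ℝ, R = 4 + 4 * ℓ / |B| := ⟨_, rfl⟩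
  have hq : 0 ≤ ℓ / |B| := by positivity
  have hR4 : 4 ≤ R := by rw [hR, mul_div_assoc]; linarith
  have hexp := Real.pow_div_factorial_le_exp (2 * R) (by linarith) 3
  have hexp' : Real.exp (-(2 * R)) ≤ 1 := Real.exp_le_one_iff.2 (by linarith)
  have hsc : Real.sinh R * Real.cosh R = (Real.exp (2 * R) - Real.exp (-(2 * R))) / 4 := by
    have := Real.sinh_two_mul R
    rw [Real.sinh_eq] at this
    linarith
  norm_num [Nat.factorial] at hexp
  have hlow : R ^ 3 / 4 ≤ Real.sinh R * Real.cosh R - R := by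
    rw [hsc]
    nlinarith [mul_nonneg (by linarith : (0 : ℝ) ≤ R) (by nlinarith : 0 ≤ R ^ 2 - 16)]
  have hh := h R (by linarith)
  rw [abs_mul, abs_sub_comm] at hh
  have h1 : R ^ 3 / 4 * |B| ≤ ℓ * R ^ 2 :=
    (mul_le_mul_of_nonneg_right (hlow.trans (le_abs_self _)) hB'.le).trans hh
  have h2 : R * |B| = 4 * |B| + 4 * ℓ := by rw [hR]; field_simp
  nlinarith [sq_nonneg R, mul_pos (pow_pos (by linarith : 0 < R) 2) hB']

/-- A twice differentiable function whose pullbacks have uniformly bounded Hessians is constant. -/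
theorem eq_of_hessian_bound {d : ℕ} (hd : 2 ≤ d) {f : HyperbolicSpace d → ℝ}
    (hf : TwiceDifferentiable f) {ℓ : ℝ}
    (hℓ : ∀ (x : HyperbolicSpace d) (s : Tangent x), ‖hessian (pullback f x) s‖ ≤ ℓ)
    (y z : HyperbolicSpace d) : f y = f z := by
  have hunit : ∀ (y : HyperbolicSpace d) (v : Tangent y), ‖v‖ = 1 →
      fderiv ℝ (f ∘ (chart d).symm) y.1.2 (Tangent.incl y v).2 = 0 := by
    intro y v hv
    obtain ⟨u, hu, hvu⟩ := Tangent.exists_unit_orthogonal hd y v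
    refine eq_zero_of_sinh_mul_cosh_bound (ℓ := ℓ) fun R hR => ?_
    have h1 := abs_le_of_hessian_bound hf hℓ y hv hu hvu hR
    -- The same `u` serves for `-v`, so the `sinh²` term is unchanged and cancels in the difference.
    have h2 := abs_le_of_hessian_bound hf hℓ y (v := -v) (by rwa [norm_neg]) hu
      (by rw [inner_neg_left, hvu, neg_zero]) hR
    rw [map_neg, Prod.snd_neg, map_neg, mul_neg] at h2
    rw [abs_le] at h1 h2 ⊢
    constructor <;> linarith [h1.1, h1.2, h2.1, h2.2]
  have hzero : ∀ p, fderiv ℝ (f ∘ (chart d).symm) p = 0 := by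
    intro p
    ext q
    obtain ⟨v, rfl⟩ := Tangent.exists_snd_eq ((chart d).symm p) q
    by_cases hv : v = 0
    · simp [hv]
    · have h := hunit ((chart d).symm p) (‖v‖⁻¹ • v)
        (by rw [norm_smul, norm_inv, norm_norm, inv_mul_cancel₀ (norm_ne_zero_iff.2 hv)])
      rw [map_smul, Prod.smul_snd, map_smul, smul_eq_mul] at h
      exact (mul_eq_zero.1 h).resolve_left (inv_ne_zero (norm_ne_zero_iff.2 hv))
  have h := is_const_of_fderiv_eq_zero hf.1 hzero (chart d y) (chart d z)
  simpa using h

end HyperbolicModel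

theorem mainTheorem9 (d : ℕ) (hd : 2 ≤ d) (f : HyperbolicModel.HyperbolicSpace d → ℝ)
    (hf : HyperbolicModel.TwiceDifferentiable f) (hne : ∃ y z, f y ≠ f z) :
    (∀ ℓ : ℝ, 0 ≤ ℓ → ∃ (x : HyperbolicModel.HyperbolicSpace d) (s : HyperbolicModel.Tangent x),
      ℓ < ‖HyperbolicModel.hessian (HyperbolicModel.pullback f x) s‖) ∧
    ¬ ∃ ℓ : ℝ≥0, ∀ y : HyperbolicModel.HyperbolicSpace d,
      LipschitzWith ℓ (gradient (HyperbolicModel.pullback f y)) := by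
  obtain ⟨y, z, hyz⟩ := hne
  constructor
  · intro ℓ _
    by_contra! h
    exact hyz (HyperbolicModel.eq_of_hessian_bound hd hf h y z)
  · rintro ⟨ℓ, h⟩
    exact hyz (HyperbolicModel.eq_of_hessian_bound hd hf
      -- A Lipschitz constant of the gradient bounds the operator norm of its derivative, so the
      -- Hessians would be uniformly bounded.
      (fun x s => norm_fderiv_le_of_lipschitz ℝ (h x)) y z)
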